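/- Let $E$ be a Borel space, i.e. a topological space homeomorphic to a Borel subset of a Polish space, let $\mathcal B(E)$ be its Borel $\sigma$-field, $\mathcal P(E)$ the space of Borel probability measures on $E$ with the topology of weak convergence, and $\mathcal A(E)$ the $\sigma$-field generated by the analytic subsets of $E$. A function $g:E\to[-\infty,\infty]$ is upper semianalytic if $\{g>c\}$ is analytic for every $c\in\mathbb R$. A gambling house is an analytic set $J\subseteq E\times\mathcal P(E)$ whose sections $J_x=\{\mu:(x,\mu)\in J\}$ are nonempty for every $x\in E$. For $f:E\to[0,\infty]$ write $\langle\mu,f\rangle=\int f\,d\mu\in[0,\infty]$ and $Jf(x)=\sup_{\mu\in J_x}\langle\mu,f\rangle$ (upper semianalytic functions being integrated with respect to the completion of $\mu$). A $J$-admissible kernel is a family $\lambda=(\lambda(x,\cdot))_{x\in E}$ of Borel probability measures on $E$ such that $x\mapsto\lambda(x,B)$ is $\mathcal A(E)$-measurable for every $B\in\mathcal B(E)$ and $(x,\lambda(x,\cdot))\in J$ for every $x\in E$. For $m\in\mathcal P(E)$ let $(m\otimes\lambda)(B)=\int_E\lambda(x,B)\,m(dx)$ for $B\in\mathcal B(E)$.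 For gambling houses $J,K$ let $$m\otimes K=\{m\otimes\lambda:\lambda\ K\text{-admissible}\},\qquad J\otimes K=\{(x,\nu):\nu\in\mu\otimes K\text{ for some }\mu\in J_x\},$$ and, for $n\ge1$ gambling houses, $J^1\otimes\cdots\otimes J^n=J^1\otimes(\cdots\otimes(J^{n-1}\otimes J^n))$. Let $\Phi:E\to[0,\infty]$ be upper semianalytic. Then: (i) for every gambling house $J$, the function $J\Phi:E\to[0,\infty]$ is upper semianalytic, and for every $m\in\mathcal P(E)$ $$\sup_{\mu\in m\otimes J}\langle\mu,\Phi\rangle=\int_E J\Phi(x)\,m(dx);$$ (ii) for all $n\ge1$ and gambling houses $J^1,\dots,J^n$, the set $J^1\otimes\cdots\otimes J^n$ is a gambling house and $$(J^1\otimes\cdots\otimes J^n)(\Phi)=J^1(\cdots J^{n-1}(J^n(\Phi))).$$ -/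

import Mathlib

open MeasureTheory
open scoped ENNReal

namespace GamblingHouse

universe u

/-- A *Borel space*: a topological space that is homeomorphic to a Borel subset of a Polish
space. -/
def IsBorelSubsetOfPolish (E : Type u) [TopologicalSpace E] : Prop :=
  ∃ (X : Type u) (_ : TopologicalSpace X) (_ : PolishSpace X) (e : E → X),
    Topology.IsEmbedding e ∧ MeasurableSet[borel X] (Set.range e)

/-- Upper semianalytic functions: every strict superlevel set at a real level is analytic. -/
def UpperSemianalytic {E : Type u} [TopologicalSpace E] (g : E → EReal) : Prop :=
  ∀ c : ℝ, AnalyticSet {x | (c : EReal) < g x}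

/-- The σ-field `𝒜(E)` generated by the analytic subsets of `E`. -/
@[reducible] def analyticSigma (E : Type u) [TopologicalSpace E] : MeasurableSpace E :=
  MeasurableSpace.generateFrom {s | AnalyticSet s}

variable {E : Type u} [TopologicalSpace E] [MeasurableSpace E] [BorelSpace E]

/-- A gambling house: an analytic subset of `E × 𝒫(E)` (where `𝒫(E)` has the topology of weak
convergence) all of whose sections are nonempty. -/
structure IsHouse (J : Set (E × ProbabilityMeasure E)) : Prop where
  analytic : AnalyticSet J
  nonempty_section : ∀ x, ∃ μ, (x, μ) ∈ J

/-- The pairing `⟨μ, f⟩ = ∫ f dμ` with values in `[0, ∞]`. Upper semianalytic functions are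
measurable for the completion of every `μ`, and the lower Lebesgue integral is then the integral
with respect to that completion. -/
noncomputable def pairing (μ : ProbabilityMeasure E) (f : E → ℝ≥0∞) : ℝ≥0∞ :=
  ∫⁻ x, f x ∂(μ : Measure E)

/-- The supremum of `⟨μ, f⟩` over a set of probability measures. -/
noncomputable def supPairing (S : Set (ProbabilityMeasure E)) (f : E → ℝ≥0∞) : ℝ≥0∞ :=
  ⨆ μ ∈ S, pairing μ f

/-- The maximal expected gain `J f (x) = sup {⟨μ, f⟩ | μ ∈ J_x}`. -/
noncomputable def gain (J : Set (E × ProbabilityMeasure E)) (f : E → ℝ≥0∞) : E → ℝ≥0∞ :=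
  fun x => supPairing {μ | (x, μ) ∈ J} f

/-- `κ` is a `J`-admissible (analytic) kernel: each `κ x` is a probability measure on the Borel sets,
`x ↦ κ x B` is `𝒜(E)`-measurable for every Borel set `B`, and `(x, κ x) ∈ J` for every `x`. -/
structure IsAdmissible (J : Set (E × ProbabilityMeasure E)) (κ : E → ProbabilityMeasure E) :
    Prop where
  measurable : ∀ B : Set E, MeasurableSet B →
    Measurable[analyticSigma E] (fun x => (κ x : Measure E) B)
  mem : ∀ x, (x, κ x) ∈ J

/-- `ν` is the composition `m ⊗ κ`, i.e. `ν(B) = ∫ κ(x, B) m(dx)` for every Borel set `B`. -/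
def IsComposition (m : ProbabilityMeasure E) (κ : E → ProbabilityMeasure E)
    (ν : ProbabilityMeasure E) : Prop :=
  ∀ B : Set E, MeasurableSet B → (ν : Measure E) B = pairing m (fun x => (κ x : Measure E) B)

/-- `m ⊗ K = {m ⊗ κ | κ a K-admissible kernel}`. -/
def measureComp (m : ProbabilityMeasure E) (K : Set (E × ProbabilityMeasure E)) :
    Set (ProbabilityMeasure E) :=
  {ν | ∃ κ, IsAdmissible K κ ∧ IsComposition m κ ν}

/-- `J ⊗ K = {(x, ν) | ν ∈ μ ⊗ K for some μ ∈ J_x}`. -/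
def houseComp (J K : Set (E × ProbabilityMeasure E)) : Set (E × ProbabilityMeasure E) :=
  {p | ∃ μ, (p.1, μ) ∈ J ∧ p.2 ∈ measureComp μ K}

/-- `J 0 ⊗ (J 1 ⊗ (⋯ ⊗ J n))`, the composition of a nonempty finite sequence of houses. -/
def houseCompSeq : (n : ℕ) → (Fin (n + 1) → Set (E × ProbabilityMeasure E)) →
    Set (E × ProbabilityMeasure E)
  | 0, J => J 0
  | n + 1, J => houseComp (J 0) (houseCompSeq n (fun i => J i.succ))

/-- `J 0 (J 1 (⋯ (J n f)))`. -/
noncomputable def gainSeq : (n : ℕ) → (Fin (n + 1) → Set (E × ProbabilityMeasure E)) →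
    (E → ℝ≥0∞) → E → ℝ≥0∞
  | 0, J, f => gain (J 0) f
  | n + 1, J, f => gain (J 0) (gainSeq n (fun i => J i.succ) f)

end GamblingHouse

/-! The space `ProbabilityMeasure E` is standard Borel, so analytic sets are stable under all the
measurable operations needed. Choquet's capacitability argument does the main work: it makes
analytic sets universally measurable, and it makes `{t | c < κ t A}` analytic when `A` is
(`setOf_lt_kernel`). A hypograph argument extends this to integrals, so `{x | c < gain J Φ x}` is
the projection of an analytic set.

For (i), `≤` is immediate from integrating kernel by kernel. For `≥`, the Jankov–von Neumann
selection theorem gives admissible kernels that attain any finite list of levels lying strictly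
below the gain; monotone convergence over the rational levels concludes.

For (ii), the difficulty is that `houseComp` is analytic, because its definition quantifies over
kernels. Replacing a kernel by the joint law `γ` of two successive positions turns this into
quantification over a point of a standard Borel space (`mem_measureComp_iff`). The gain identity is
then (i) applied at each `μ`, followed by induction. -/

namespace GamblingHouse

open Set Filter Topology TopologicalSpace ProbabilityTheory

/-! ### The weak topology on probability measures and its Borel σ-field. -/

section ProbabilityMeasureSpace

variable {X : Type*} [TopologicalSpace X] [MeasurableSpace X]

theorem lowerSemicontinuous_measure_of_isOpen [OpensMeasurableSpace X] [HasOuterApproxClosed X]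
    {U : Set X} (hU : IsOpen U) :
    LowerSemicontinuous fun μ : ProbabilityMeasure X ↦ (μ : Measure X) U := by
  intro μ c hc
  exact eventually_lt_of_lt_liminf
    (hc.trans_le (ProbabilityMeasure.le_liminf_measure_open_of_tendsto tendsto_id hU))

/-- The sets `{μ | q < μ U}`, with `q` rational and `U` a finite union of basic open sets, form the
subbasis. They generate a second countable topology, so its neighbourhood filters are countably
generated and the portmanteau criterion applies to the identity map. An open set is exhausted in
measure by such finite unions `U`. -/
theorem exists_countable_generateFrom_probabilityMeasure [SecondCountableTopology X]
    [OpensMeasurableSpace X] [HasOuterApproxClosed X] :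
    ∃ S : Set (Set (ProbabilityMeasure X)), S.Countable ∧ (∀ s ∈ S, MeasurableSet s) ∧
      (inferInstance : TopologicalSpace (ProbabilityMeasure X)) = generateFrom S := by
  let F : Set (Set X) := {U | ∃ s : Set (Set X), s ⊆ countableBasis X ∧ s.Finite ∧ ⋃₀ s = U}
  have hFo : ∀ U ∈ F, IsOpen U := by
    rintro _ ⟨s, hs, -, rfl⟩
    exact isOpen_sUnion fun t ht ↦ isOpen_of_mem_countableBasis (hs ht)
  have hFc : F.Countable := by
    have h := (countable_ofPred_finite_subset (countable_countableBasis X)).image sUnion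
    refine h.mono ?_
    rintro _ ⟨s, hs, hf, rfl⟩
    exact ⟨s, ⟨hf, hs⟩, rfl⟩
  let g : Set X × ℚ → Set (ProbabilityMeasure X) :=
    fun p ↦ {μ | ENNReal.ofReal p.2 < (μ : Measure X) p.1}
  have hSc : (g '' (F ×ˢ (univ : Set ℚ))).Countable := (hFc.prod countable_univ).image g
  refine ⟨g '' (F ×ˢ univ), hSc, ?_, ?_⟩
  · rintro _ ⟨⟨U, q⟩, ⟨hU, -⟩, rfl⟩
    exact measurableSet_lt measurable_const
      ((Measure.measurable_coe (hFo U hU).measurableSet).comp measurable_subtype_coe)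
  apply le_antisymm
  · refine le_generateFrom ?_
    rintro _ ⟨⟨U, q⟩, ⟨hU, -⟩, rfl⟩
    exact (lowerSemicontinuous_measure_of_isOpen (hFo U hU)).isOpen_preimage _
  · let t' := generateFrom (g '' (F ×ˢ (univ : Set ℚ)))
    have h2 : @SecondCountableTopology _ t' := @SecondCountableTopology.mk _ t' ⟨_, hSc, rfl⟩
    refine le_of_nhds_le_nhds fun μ ↦ ?_
    have : (@nhds _ t' μ).IsCountablyGenerated :=
      @FirstCountableTopology.nhds_generated_countable _ t' inferInstance μ
    refine tendsto_of_forall_isOpen_le_liminf' (μs := id) fun G hG ↦ ?_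
    refine le_of_forall_lt fun c hc ↦ ?_
    let B : Set (Set X) := {b ∈ countableBasis X | b ⊆ G}
    have hB : B.Countable := (countable_countableBasis X).mono (sep_subset _ _)
    have hGB : G = ⋃₀ B := (isBasis_countableBasis X).open_eq_sUnion' hG
    obtain ⟨s, hs, hsf, hcs⟩ : ∃ s ⊆ B, s.Finite ∧ c < (μ : Measure X) (⋃₀ s) := by
      have : Countable B := hB.to_subtype
      have hU : ⋃₀ B = ⋃ s : Finset B, ⋃ b ∈ s, (b : Set X) := by
        ext x
        simp only [mem_sUnion, mem_iUnion]
        exact ⟨fun ⟨t, ht, hx⟩ ↦ ⟨{⟨t, ht⟩}, ⟨t, ht⟩, by simp, hx⟩,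
          fun ⟨_, t, _, hx⟩ ↦ ⟨t, t.2, hx⟩⟩
      have hd : Directed (· ⊆ ·) fun s : Finset B ↦ ⋃ b ∈ s, (b : Set X) :=
        Monotone.directed_le fun s t hst ↦ biUnion_subset_biUnion_left hst
      rw [hGB, hU, hd.measure_iUnion, lt_iSup_iff] at hc
      obtain ⟨s, hs⟩ := hc
      refine ⟨(↑) '' (s : Set B), ?_, s.finite_toSet.image _, ?_⟩
      · rintro _ ⟨b, -, rfl⟩
        exact b.2
      · simpa [sUnion_image] using hs
    obtain ⟨q, hq, hcq, hqs⟩ := ENNReal.lt_iff_exists_rat_btwn.1 hcs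
    have hev : ∀ᶠ ν in @nhds _ t' μ, ν ∈ g (⋃₀ s, q) := by
      refine @IsOpen.mem_nhds _ t' μ _ ?_ ?_
      · exact isOpen_generateFrom_of_mem
          ⟨_, ⟨⟨s, hs.trans (sep_subset _ _), hsf, rfl⟩, mem_univ _⟩, rfl⟩
      · exact hqs
    refine hcq.trans_le (le_liminf_of_le (by isBoundedDefault) ?_)
    filter_upwards [hev] with ν hν
    exact (le_of_lt hν).trans (measure_mono (sUnion_subset fun t ht ↦ (hs ht).2))

instance [SecondCountableTopology X] [OpensMeasurableSpace X] [HasOuterApproxClosed X] :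
    SecondCountableTopology (ProbabilityMeasure X) := by
  obtain ⟨S, hS, -, h⟩ := exists_countable_generateFrom_probabilityMeasure (X := X)
  exact ⟨S, hS, h⟩

theorem measurable_measure_of_isOpen [BorelSpace X] {α : Type*} [MeasurableSpace α]
    {κ : α → Measure X} [∀ a, IsProbabilityMeasure (κ a)]
    (h : ∀ U, IsOpen U → Measurable fun a ↦ κ a U) : Measurable κ :=
  .measure_of_isPiSystem_of_isProbabilityMeasure (BorelSpace.measurable_eq) isPiSystem_isOpen h

instance [SecondCountableTopology X] [BorelSpace X] [HasOuterApproxClosed X] :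
    BorelSpace (ProbabilityMeasure X) := by
  obtain ⟨S, hS, hSm, h⟩ := exists_countable_generateFrom_probabilityMeasure (X := X)
  refine ⟨le_antisymm ?_ ?_⟩
  · have : @Measurable _ _ (borel (ProbabilityMeasure X)) _
        (fun μ : ProbabilityMeasure X ↦ (μ : Measure X)) :=
      @measurable_measure_of_isOpen X _ _ _ _ (borel _) _ (fun μ ↦ inferInstance) fun U hU ↦
        by apply measurable_of_Ioi; exact fun c ↦
          .basic _ ((lowerSemicontinuous_measure_of_isOpen hU).isOpen_preimage c)
    exact this.comap_le
  · rw [borel_eq_generateFrom_of_subbasis h]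
    exact MeasurableSpace.generateFrom_le hSm

end ProbabilityMeasureSpace

/-! ### Probability measures on a standard Borel space form a standard Borel space. -/

theorem standardBorelSpace_of_measurableEquiv {α β : Type*} [MeasurableSpace α]
    [MeasurableSpace β] [StandardBorelSpace α] (e : β ≃ᵐ α) : StandardBorelSpace β := by
  let := upgradeStandardBorel α
  refine ⟨TopologicalSpace.induced e inferInstance,
    @BorelSpace.mk _ (TopologicalSpace.induced e inferInstance) _ ?_, e.toEquiv.polishSpace_induced⟩
  rw [borel_comap, ← BorelSpace.measurable_eq (α := α)]
  exact e.measurableEmbedding.comap_eq.symm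

theorem measure_real_ext_of_Iic_rat {μ ν : Measure ℝ} [IsProbabilityMeasure μ]
    [IsProbabilityMeasure ν] (h : ∀ q : ℚ, μ (Iic (q : ℝ)) = ν (Iic (q : ℝ))) : μ = ν := by
  refine ext_of_generate_finite _
    (BorelSpace.measurable_eq.trans Real.borel_eq_generateFrom_Iic_rat) Real.isPiSystem_Iic_rat
    ?_ (by simp)
  intro s hs
  obtain ⟨q, rfl⟩ := mem_iUnion.1 hs
  exact h q

/-- After embedding `X` in `ℝ`, a law is encoded by the values of its cdf at rationals; the codes
form a Borel subset of `ℚ → ℝ`. -/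
instance {X : Type*} [MeasurableSpace X] [StandardBorelSpace X] :
    StandardBorelSpace (ProbabilityMeasure X) := by
  let e := embeddingReal X
  have he : MeasurableEmbedding e := measurableEmbedding_embeddingReal X
  let ρ : (ℚ → ℝ) → Measure ℝ := fun F ↦
    (stieltjesOfMeasurableRat (id : (ℚ → ℝ) → ℚ → ℝ) measurable_id F).measure
  have hρ : Measurable ρ := measurable_measure_stieltjesOfMeasurableRat measurable_id
  have hρP : ∀ F, IsProbabilityMeasure (ρ F) := fun F ↦ inferInstance
  -- `ρ F` is a probability measure even when `F` is not the trace of a cdf, so `S` demands that `ρ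
  -- F` give back `F`. The sign condition is needed since `ENNReal.ofReal` sends negative values to
  -- `0`.
  let S : Set (ℚ → ℝ) := {F | ρ F (range e) = 1 ∧ ∀ q : ℚ, ρ F (Iic (q : ℝ)) = ENNReal.ofReal (F q)
    ∧ 0 ≤ F q}
  have hS : MeasurableSet S := by
    refine (measurableSet_eq_fun ((Measure.measurable_coe he.measurableSet_range).comp hρ)
      measurable_const).inter (measurableSet_setOfPred.2 (Measurable.forall fun q ↦ ?_))
    refine measurableSet_setOfPred.1 ?_
    exact (measurableSet_eq_fun ((Measure.measurable_coe measurableSet_Iic).comp hρ)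
      (measurable_pi_apply q).ennreal_ofReal).inter
      (measurableSet_le measurable_const (measurable_pi_apply q))
  have : StandardBorelSpace S := hS.standardBorel
  have hρS : ∀ F ∈ S, ((ρ F).comap e).map e = ρ F := by
    intro F hF
    rw [he.map_comap, Measure.restrict_eq_self_of_ae_mem]
    exact (prob_compl_eq_zero_iff he.measurableSet_range).2 hF.1
  have hP : ∀ μ : ProbabilityMeasure X, IsProbabilityMeasure ((μ : Measure X).map e) :=
    fun μ ↦ Measure.isProbabilityMeasure_map he.measurable.aemeasurable
  have hμρ : ∀ μ : ProbabilityMeasure X, ρ (fun q ↦ cdf ((μ : Measure X).map e) q) =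
      (μ : Measure X).map e := by
    intro μ
    have := hP μ
    refine measure_real_ext_of_Iic_rat fun q ↦ ?_
    rw [measure_stieltjesOfMeasurableRat_Iic, stieltjesOfMeasurableRat_eq,
      toRatCDF_of_isRatStieltjesPoint, id, ofReal_cdf]
    refine ⟨fun p q hpq ↦ monotone_cdf _ (by exact_mod_cast hpq),
      (tendsto_cdf_atTop _).comp (tendsto_ratCast_atTop_iff.2 tendsto_id),
      (tendsto_cdf_atBot _).comp (tendsto_ratCast_atBot_iff.2 tendsto_id), fun t ↦ ?_⟩
    rw [id, ← StieltjesFunction.iInf_rat_gt_eq]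
    exact Equiv.iInf_congr (Equiv.subtypeEquivRight fun r ↦ by simp) fun r ↦ rfl
  refine standardBorelSpace_of_measurableEquiv (α := S)
    { toFun := fun μ ↦ ⟨fun q ↦ cdf ((μ : Measure X).map e) q, ?_, fun q ↦ ⟨?_, cdf_nonneg _ _⟩⟩
      invFun := fun F ↦ ⟨(ρ F).comap e, ?_⟩
      left_inv := ?_
      right_inv := ?_
      measurable_toFun := ?_
      measurable_invFun := ?_ }
  · rw [hμρ, he.map_apply, preimage_range, measure_univ]
  · have := hP μ
    rw [hμρ, ofReal_cdf]
  · refine ⟨?_⟩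
    rw [he.comap_apply, image_univ, F.2.1]
  · intro μ
    refine Subtype.ext ?_
    change (ρ fun q ↦ cdf ((μ : Measure X).map e) q).comap e = μ
    rw [hμρ, he.comap_map]
  · rintro ⟨F, hF⟩
    refine Subtype.ext (funext fun q ↦ ?_)
    change cdf (((ρ F).comap e).map e) q = F q
    rw [hρS F hF, cdf_eq_real, measureReal_def, (hF.2 q).1, ENNReal.toReal_ofReal (hF.2 q).2]
  · refine Measurable.subtype_mk (measurable_pi_iff.2 fun q ↦ ?_)
    have : (fun μ : ProbabilityMeasure X ↦ cdf ((μ : Measure X).map e) q) =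
        fun μ : ProbabilityMeasure X ↦ ((μ : Measure X).map e (Iic (q : ℝ))).toReal := by
      ext μ
      have := hP μ
      rw [cdf_eq_real, measureReal_def]
    rw [this]
    exact ((Measure.measurable_coe measurableSet_Iic).comp
      ((Measure.measurable_map e he.measurable).comp measurable_subtype_coe)).ennreal_toReal
  · refine Measurable.subtype_mk (Measure.measurable_of_measurable_coe _ fun s hs ↦ ?_)
    simp_rw [he.comap_apply]
    exact (Measure.measurable_coe (he.measurableSet_image.2 hs)).comp
      (hρ.comp measurable_subtype_coe)

/-! ### Stability of analytic sets under measurable images and preimages. -/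

theorem _root_.MeasureTheory.AnalyticSet.exists_range_eq {X : Type*} [TopologicalSpace X] {s : Set X}
    (hs : AnalyticSet s)
    (hne : s.Nonempty) : ∃ f : (ℕ → ℕ) → X, Continuous f ∧ range f = s := by
  rw [AnalyticSet] at hs
  exact hs.resolve_left hne.ne_empty

theorem _root_.MeasureTheory.AnalyticSet.inter {X : Type*} [TopologicalSpace X] [T2Space X] {s t : Set X}
    (hs : AnalyticSet s) (ht : AnalyticSet t) : AnalyticSet (s ∩ t) := by
  rw [inter_eq_iInter]
  exact AnalyticSet.iInter (by rintro (_ | _) <;> assumption)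

section AnalyticTools

variable {X Y : Type*} [TopologicalSpace X] [MeasurableSpace X] [TopologicalSpace Y]
  [MeasurableSpace Y]

theorem analyticSet_of_measurableSet [SecondCountableTopology X] [OpensMeasurableSpace X]
    [StandardBorelSpace X] {s : Set X} (hs : MeasurableSet s) : AnalyticSet s := by
  simpa using hs.analyticSet_image measurable_id

theorem _root_.MeasureTheory.AnalyticSet.image_of_measurable [BorelSpace X]
    [SecondCountableTopology Y] [OpensMeasurableSpace Y] {s : Set X} (hs : AnalyticSet s)
    {f : X → Y} (hf : Measurable f) : AnalyticSet (f '' s) := by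
  rcases s.eq_empty_or_nonempty with rfl | hne
  · simpa using analyticSet_empty
  obtain ⟨g, hg, rfl⟩ := hs.exists_range_eq hne
  rw [← range_comp, ← image_univ]
  exact MeasurableSet.univ.analyticSet_image (hf.comp hg.measurable)

theorem _root_.MeasureTheory.AnalyticSet.preimage_of_measurable [SecondCountableTopology X]
    [OpensMeasurableSpace X] [StandardBorelSpace X] [BorelSpace Y] [MeasurableEq Y]
    {s : Set Y} (hs : AnalyticSet s) {f : X → Y} (hf : Measurable f) : AnalyticSet (f ⁻¹' s) := by
  rcases s.eq_empty_or_nonempty with rfl | hne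
  · simpa using analyticSet_empty
  obtain ⟨g, hg, rfl⟩ := hs.exists_range_eq hne
  have hm : MeasurableSet {p : X × (ℕ → ℕ) | f p.1 = g p.2} :=
    measurableSet_eq_fun (hf.comp measurable_fst) (hg.measurable.comp measurable_snd)
  convert hm.analyticSet_image measurable_fst
  ext x
  simp [eq_comm]

end AnalyticTools

/-! ### Capacitability and universal measurability of analytic sets. -/

/-- Sequences whose initial segment (listed in reverse) is pointwise bounded by `s`. -/
def boundedBy (s : List ℕ) : Set (ℕ → ℕ) :=
  {σ | List.Forall₂ (· ≤ ·) (PiNat.res σ s.length) s}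

theorem mem_boundedBy_cons {k : ℕ} {s : List ℕ} {σ : ℕ → ℕ} :
    σ ∈ boundedBy (k :: s) ↔ σ s.length ≤ k ∧ σ ∈ boundedBy s := by
  simp [boundedBy]

theorem mem_boundedBy_res {τ σ : ℕ → ℕ} {n : ℕ} :
    σ ∈ boundedBy (PiNat.res τ n) ↔ ∀ i < n, σ i ≤ τ i := by
  induction n with
  | zero => simp [boundedBy]
  | succ n ih =>
    rw [PiNat.res_succ, mem_boundedBy_cons, PiNat.res_length, ih, Nat.forall_lt_succ_right, and_comm]

/-- The sequence generated by repeatedly prepending `k s` to the list `s` built so far. -/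
theorem exists_seq_res (k : List ℕ → ℕ) : ∃ τ : ℕ → ℕ, ∀ n, τ n = k (PiNat.res τ n) := by
  let p : ℕ → List ℕ := fun n ↦ Nat.rec [] (fun _ s ↦ k s :: s) n
  refine ⟨fun n ↦ k (p n), fun n ↦ ?_⟩
  have : ∀ n, PiNat.res (fun n ↦ k (p n)) n = p n := by
    intro n
    induction n with
    | zero => rfl
    | succ n ih => rw [PiNat.res_succ, ih]
  rw [this]

theorem exists_cylinder_subset {W : Set (ℕ → ℕ)} (hW : IsOpen W) {σ : ℕ → ℕ} (hσ : σ ∈ W) :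
    ∃ n, PiNat.cylinder σ n ⊆ W := by
  obtain ⟨_, ⟨⟨y, n, rfl⟩, h1, h2⟩⟩ :=
    (PiNat.isTopologicalBasis_cylinders (fun _ ↦ ℕ)).exists_subset_of_mem_open hσ hW
  exact ⟨n, by rwa [PiNat.mem_cylinder_iff_eq.1 h1]⟩

/-- The sequences bounded by `τ` everywhere form a compact set `K`. A point outside `range f` is
separated from `f '' K` by open sets, and by compactness the one around `f '' K` contains the images
of all length-`n` cylinders about points of `K`, for a single `n`. -/
theorem iInter_closure_image_boundedBy_subset {Z : Type*}
    [TopologicalSpace Z] [T2Space Z] {f : (ℕ → ℕ) → Z}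
    (hf : Continuous f) (τ : ℕ → ℕ) : ⋂ n, closure (f '' boundedBy (PiNat.res τ n)) ⊆ range f := by
  intro y hy
  by_contra hyf
  let K : Set (ℕ → ℕ) := Set.pi univ fun i ↦ Iic (τ i)
  have hK : IsCompact K := isCompact_univ_pi fun i ↦ (finite_Iic (τ i)).isCompact
  have hdisj : Disjoint (f '' K) {y} := by
    rw [disjoint_singleton_right]
    exact fun h ↦ hyf (image_subset_range _ _ h)
  obtain ⟨U, V, hU, hV, hKU, hyV, hUV⟩ :=
    SeparatedNhds.of_isCompact_isCompact (hK.image hf) isCompact_singleton hdisj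
  have hW : IsOpen (f ⁻¹' U) := hU.preimage hf
  obtain ⟨n, hn⟩ : ∃ n, ∀ σ ∈ K, PiNat.cylinder σ n ⊆ f ⁻¹' U := by
    refine hK.induction_on (p := fun S ↦ ∃ n, ∀ σ ∈ S, PiNat.cylinder σ n ⊆ f ⁻¹' U)
      ⟨0, by simp⟩ (fun S T hST ⟨n, hn⟩ ↦ ⟨n, fun σ hσ ↦ hn σ (hST hσ)⟩) ?_ ?_
    · rintro S T ⟨n, hn⟩ ⟨m, hm⟩
      refine ⟨max n m, ?_⟩
      rintro σ (hσ | hσ)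
      · exact (PiNat.cylinder_anti σ (le_max_left n m)).trans (hn σ hσ)
      · exact (PiNat.cylinder_anti σ (le_max_right n m)).trans (hm σ hσ)
    · intro σ hσ
      obtain ⟨n, hn⟩ := exists_cylinder_subset hW (hKU (mem_image_of_mem f hσ))
      refine ⟨PiNat.cylinder σ n, mem_nhdsWithin_of_mem_nhds
        ((PiNat.isOpen_cylinder _ σ n).mem_nhds (PiNat.self_mem_cylinder σ n)), n, fun ρ hρ ↦ ?_⟩
      rwa [PiNat.mem_cylinder_iff_eq.1 hρ]
  have hsub : f '' boundedBy (PiNat.res τ n) ⊆ U := by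
    rintro _ ⟨σ, hσ, rfl⟩
    rw [mem_boundedBy_res] at hσ
    -- Truncating `σ` after `n` terms gives a point of `K` whose length-`n` cylinder contains `σ`.
    refine hn (fun i ↦ if i < n then σ i else 0) ?_ ?_
    · intro i _
      by_cases h : i < n <;> simp [h, hσ]
    · intro i hi
      simp [hi]
  have hy' := mem_iInter.1 hy n
  obtain ⟨z, hzV, hz⟩ := mem_closure_iff.1 hy' V hV (hyV rfl)
  exact hUV.le_bot ⟨hsub hz, hzV⟩

section Capacity

variable {Z : Type*} [MeasurableSpace Z]

/-- Bounds are chosen one coordinate at a time: continuity from below, valid for the outer measure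
of arbitrary sets, keeps the measure above `c`. -/
theorem exists_lt_measure_image_boundedBy (μ : Measure Z) (f : (ℕ → ℕ) → Z) {c : ℝ≥0∞}
    (hc : c < μ (range f)) : ∃ τ : ℕ → ℕ, ∀ n, c < μ (f '' boundedBy (PiNat.res τ n)) := by
  have step : ∀ s : List ℕ, ∃ k, c < μ (f '' boundedBy s) → c < μ (f '' boundedBy (k :: s)) := by
    intro s
    by_cases h : c < μ (f '' boundedBy s)
    · have hU : f '' boundedBy s = ⋃ k, f '' boundedBy (k :: s) := by
        rw [← image_iUnion]
        congr 1
        ext σ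
        simp only [mem_iUnion, mem_boundedBy_cons, exists_and_right]
        exact ⟨fun h ↦ ⟨⟨_, le_rfl⟩, h⟩, fun h ↦ h.2⟩
      have hd : Directed (· ⊆ ·) fun k ↦ f '' boundedBy (k :: s) := by
        refine Monotone.directed_le fun k l hkl ↦ image_mono fun σ hσ ↦ ?_
        rw [mem_boundedBy_cons] at hσ ⊢
        exact ⟨hσ.1.trans hkl, hσ.2⟩
      have h' := h
      rw [hU, hd.measure_iUnion, lt_iSup_iff] at h'
      exact h'.imp fun k hk _ ↦ hk
    · exact ⟨0, fun h' ↦ absurd h' h⟩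
  choose k hk using step
  obtain ⟨τ, hτ⟩ := exists_seq_res k
  refine ⟨τ, fun n ↦ ?_⟩
  induction n with
  | zero => simpa [boundedBy] using hc
  | succ n ih =>
    rw [PiNat.res_succ, hτ n]
    exact hk _ ih

variable [TopologicalSpace Z]

theorem le_measure_iInter_closure_image_boundedBy [OpensMeasurableSpace Z] {μ : Measure Z}
    [IsFiniteMeasure μ] {f : (ℕ → ℕ) → Z} {τ : ℕ → ℕ} {c : ℝ≥0∞}
    (h : ∀ n, c ≤ μ (closure (f '' boundedBy (PiNat.res τ n)))) :
    c ≤ μ (⋂ n, closure (f '' boundedBy (PiNat.res τ n))) := by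
  rw [Antitone.measure_iInter (fun n m hnm ↦ closure_mono (image_mono fun σ hσ ↦ ?_))
    (fun n ↦ isClosed_closure.measurableSet.nullMeasurableSet) ⟨0, measure_ne_top _ _⟩]
  · exact le_iInf h
  · rw [mem_boundedBy_res] at hσ ⊢
    exact fun i hi ↦ hσ i (hi.trans_le hnm)

theorem _root_.MeasureTheory.AnalyticSet.exists_isClosed_subset [OpensMeasurableSpace Z] [T2Space Z]
    {A : Set Z} (hA : AnalyticSet A) (μ : Measure Z) [IsFiniteMeasure μ] {c : ℝ≥0∞}
    (hc : c < μ A) : ∃ C ⊆ A, IsClosed C ∧ c ≤ μ C := by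
  obtain ⟨f, hf, rfl⟩ := hA.exists_range_eq (nonempty_of_measure_ne_zero (hc.ne_bot))
  obtain ⟨τ, hτ⟩ := exists_lt_measure_image_boundedBy μ f hc
  exact ⟨_, iInter_closure_image_boundedBy_subset hf τ, isClosed_iInter fun _ ↦ isClosed_closure,
    le_measure_iInter_closure_image_boundedBy
      fun n ↦ (hτ n).le.trans (measure_mono subset_closure)⟩

/-- Closed inner approximations at the rational levels have a union of full measure in `A`. -/
theorem _root_.MeasureTheory.AnalyticSet.nullMeasurableSet [OpensMeasurableSpace Z] [T2Space Z]
    {A : Set Z} (hA : AnalyticSet A) (μ : Measure Z) [IsFiniteMeasure μ] :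
    NullMeasurableSet A μ := by
  have h : ∀ q : ℚ, ∃ C ⊆ A, IsClosed C ∧ (ENNReal.ofReal q < μ A → ENNReal.ofReal q ≤ μ C) := by
    intro q
    by_cases hq : ENNReal.ofReal q < μ A
    · obtain ⟨C, hCA, hC, hqC⟩ := hA.exists_isClosed_subset μ hq
      exact ⟨C, hCA, hC, fun _ ↦ hqC⟩
    · exact ⟨∅, empty_subset _, isClosed_empty, fun h ↦ absurd h hq⟩
  choose C hCA hC hqC using h
  have hB : MeasurableSet (⋃ q, C q) := MeasurableSet.iUnion fun q ↦ (hC q).measurableSet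
  refine hB.nullMeasurableSet.congr
    (ae_eq_of_subset_of_measure_ge (iUnion_subset hCA) ?_ hB.nullMeasurableSet (measure_ne_top _ _))
  refine le_of_forall_lt fun c hc ↦ ?_
  obtain ⟨q, -, hcq, hqA⟩ := ENNReal.lt_iff_exists_rat_btwn.1 hc
  exact hcq.trans_le ((hqC q hqA).trans (measure_mono (subset_iUnion C q)))

theorem measurableSet_res_eq (n : ℕ) (s : List ℕ) :
    MeasurableSet {τ : ℕ → ℕ | PiNat.res τ n = s} := by
  rcases {τ : ℕ → ℕ | PiNat.res τ n = s}.eq_empty_or_nonempty with h | ⟨τ, rfl⟩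
  · rw [h]
    exact MeasurableSet.empty
  · rw [← PiNat.cylinder_eq_res]
    exact (PiNat.isOpen_cylinder _ τ n).measurableSet

/-- By the capacity argument, `c < κ t A` holds iff, for some rational `q` above `c` and some `τ`,
every closed set `F (PiNat.res τ n)` has `κ t`-measure at least `q`. Only countably many closed sets
occur, so this condition on `(t, τ)` is Borel, and `τ` is projected away. -/
theorem _root_.MeasureTheory.AnalyticSet.setOf_lt_kernel [OpensMeasurableSpace Z] [T2Space Z]
    {T : Type*} [MeasurableSpace T] [StandardBorelSpace T] [TopologicalSpace T]
    [SecondCountableTopology T] [OpensMeasurableSpace T] {A : Set Z} (hA : AnalyticSet A)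
    (κ : Kernel T Z) [IsFiniteKernel κ] (c : ℝ≥0∞) : AnalyticSet {t | c < κ t A} := by
  rcases A.eq_empty_or_nonempty with rfl | hne
  · simpa using analyticSet_empty
  obtain ⟨f, hf, rfl⟩ := hA.exists_range_eq hne
  let F : List ℕ → Set Z := fun s ↦ closure (f '' boundedBy s)
  have hU : {t | c < κ t (range f)} = ⋃ q : {q : ℚ // c < ENNReal.ofReal q}, Prod.fst ''
      {p : T × (ℕ → ℕ) | ∀ n, ENNReal.ofReal q ≤ κ p.1 (F (PiNat.res p.2 n))} := by
    ext t
    simp only [mem_ofPred_eq, mem_iUnion, mem_image, Prod.exists, exists_and_right, exists_eq_right]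
    constructor
    · intro hc
      obtain ⟨q, -, hcq, hq⟩ := ENNReal.lt_iff_exists_rat_btwn.1 hc
      obtain ⟨τ, hτ⟩ := exists_lt_measure_image_boundedBy (κ t) f hq
      exact ⟨⟨q, hcq⟩, τ, fun n ↦ (hτ n).le.trans (measure_mono subset_closure)⟩
    · rintro ⟨⟨q, hcq⟩, τ, hτ⟩
      exact hcq.trans_le ((le_measure_iInter_closure_image_boundedBy hτ).trans
        (measure_mono (iInter_closure_image_boundedBy_subset hf τ)))
  rw [hU]
  refine AnalyticSet.iUnion fun q ↦ MeasurableSet.analyticSet_image ?_ measurable_fst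
  have hI : {p : T × (ℕ → ℕ) | ∀ n, ENNReal.ofReal q ≤ κ p.1 (F (PiNat.res p.2 n))} =
      ⋂ n, ⋃ s, {t | ENNReal.ofReal q ≤ κ t (F s)} ×ˢ {τ | PiNat.res τ n = s} := by
    ext p
    simp
  rw [hI]
  exact MeasurableSet.iInter fun n ↦ MeasurableSet.iUnion fun s ↦
    (measurableSet_le measurable_const (κ.measurable_coe isClosed_closure.measurableSet)).prod
      (measurableSet_res_eq n s)

end Capacity

/-! ### Measurable selection from analytic sets. -/

section Selection

variable {X : Type*} [TopologicalSpace X]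

theorem measurableSet_analyticSigma {s : Set X} (hs : AnalyticSet s) :
    MeasurableSet[analyticSigma X] s :=
  MeasurableSpace.measurableSet_generateFrom hs

theorem measurable_analyticSigma_ite {Y : Type*} [MeasurableSpace Y] {p : X → Prop}
    [DecidablePred p] {f g : X → Y} (hp : MeasurableSet[analyticSigma X] {x | p x})
    (hf : Measurable[analyticSigma X] f) (hg : Measurable[analyticSigma X] g) :
    Measurable[analyticSigma X] fun x ↦ if p x then f x else g x := by
  let := analyticSigma X
  exact Measurable.ite hp hf hg

/-- A continuous map on Baire space has a right inverse that is measurable for the σ-field generated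
by the analytic sets: pick the lexicographically least point of each fibre. -/
theorem exists_measurable_rightInverse [T1Space X] {g : (ℕ → ℕ) → X} (hg : Continuous g) :
    ∃ σ : X → ℕ → ℕ, Measurable[analyticSigma X] σ ∧ ∀ x ∈ range g, g (σ x) = x := by
  let := analyticSigma X
  let D : List ℕ → Set X := fun s ↦ g '' {τ | PiNat.res τ s.length = s}
  have hD : ∀ s, MeasurableSet (D s) := fun s ↦ measurableSet_analyticSigma
    ((measurableSet_res_eq _ s).analyticSet.image_of_continuous hg)
  choose σ hσ using fun x ↦ exists_seq_res fun s ↦ sInf {k | x ∈ D (k :: s)}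
  have hsInf : ∀ s k, MeasurableSet {x | sInf {k | x ∈ D (k :: s)} = k} := by
    intro s k
    -- The second set of the union covers the convention `sInf ∅ = 0`.
    have h : {x | sInf {k | x ∈ D (k :: s)} = k} =
        (D (k :: s) ∩ ⋂ j, ⋂ (_ : j < k), (D (j :: s))ᶜ) ∪
          ({_x : X | k = 0} ∩ ⋂ j, (D (j :: s))ᶜ) := by
      ext x
      simp only [mem_ofPred_eq, mem_union, mem_inter_iff, mem_iInter, mem_compl_iff]
      constructor
      · rintro rfl
        rcases {k | x ∈ D (k :: s)}.eq_empty_or_nonempty with he | hne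
        · exact Or.inr ⟨by rw [he, Nat.sInf_empty], fun j hj ↦ by
            have : j ∈ {k | x ∈ D (k :: s)} := hj
            simp [he] at this⟩
        · exact Or.inl ⟨Nat.sInf_mem hne, fun j hj ↦ Nat.notMem_of_lt_sInf hj⟩
      · rintro (⟨h1, h2⟩ | ⟨rfl, h⟩)
        · refine le_antisymm (Nat.sInf_le h1) ?_
          by_contra! hlt
          exact h2 _ hlt (Nat.sInf_mem (s := {k | x ∈ D (k :: s)}) ⟨k, h1⟩)
        · simp [h]
    rw [h]
    exact ((hD _).inter (MeasurableSet.iInter fun j ↦ MeasurableSet.iInter fun _ ↦ (hD _).compl)).union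
      ((MeasurableSet.const _).inter (MeasurableSet.iInter fun j ↦ (hD _).compl))
  have hres : ∀ n s, MeasurableSet {x | PiNat.res (σ x) n = s} := by
    intro n
    induction n with
    | zero => exact fun s ↦ MeasurableSet.const ([] = s)
    | succ n ih =>
      rintro (_ | ⟨k, s⟩)
      · simp
      · convert (ih s).inter (hsInf s k) using 1
        ext x
        simp only [PiNat.res_succ, List.cons.injEq, mem_ofPred_eq, mem_inter_iff, hσ x n]
        constructor
        · rintro ⟨h1, h2⟩
          exact ⟨h2, h2 ▸ h1⟩
        · rintro ⟨h1, h2⟩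
          exact ⟨h1 ▸ h2, h1⟩
  refine ⟨σ, measurable_pi_iff.2 fun n ↦ measurable_to_countable' fun k ↦ ?_, ?_⟩
  · have : (fun x ↦ σ x n) ⁻¹' {k} = ⋃ s, {x | PiNat.res (σ x) (n + 1) = k :: s} := by
      ext x
      simp
    rw [this]
    exact MeasurableSet.iUnion fun s ↦ hres _ _
  · intro x hx
    have hmem : ∀ n, x ∈ D (PiNat.res (σ x) n) := by
      intro n
      induction n with
      | zero => simpa [D] using hx
      | succ n ih =>
        obtain ⟨τ, hτ, hx⟩ := ih
        rw [mem_ofPred_eq, PiNat.res_length] at hτ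
        rw [PiNat.res_succ, hσ x n]
        refine Nat.sInf_mem (s := {k | x ∈ D (k :: PiNat.res (σ x) n)}) ⟨τ n, τ, ?_, hx⟩
        simp [hτ]
    by_contra hne
    -- If `g (σ x) ≠ x`, continuity gives a cylinder about `σ x` missing the fibre over `x`, while
    -- `hmem` puts a point of the fibre in every such cylinder.
    obtain ⟨n, hn⟩ := exists_cylinder_subset (isOpen_compl_singleton.preimage hg) hne
    obtain ⟨τ, hτ, hx⟩ := hmem n
    rw [mem_ofPred_eq, PiNat.res_length] at hτ
    refine hn (a := τ) ?_ hx
    rw [PiNat.cylinder_eq_res]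
    exact hτ

theorem _root_.MeasureTheory.AnalyticSet.exists_measurable_selection [T1Space X] {Y : Type*}
    [TopologicalSpace Y] [MeasurableSpace Y] [BorelSpace Y] {A : Set (X × Y)} (hA : AnalyticSet A)
    (hne : A.Nonempty) :
    ∃ s : X → Y, Measurable[analyticSigma X] s ∧ ∀ x ∈ Prod.fst '' A, (x, s x) ∈ A := by
  obtain ⟨f, hf, rfl⟩ := hA.exists_range_eq hne
  obtain ⟨σ, hσ, h⟩ := exists_measurable_rightInverse (continuous_fst.comp hf)
  refine ⟨fun x ↦ (f (σ x)).2, (continuous_snd.comp hf).measurable.comp hσ, fun x hx ↦ ?_⟩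
  rw [← range_comp] at hx
  exact ⟨σ x, Prod.ext (h x hx) rfl⟩

variable [MeasurableSpace X] [OpensMeasurableSpace X] [T2Space X]

theorem aemeasurable_of_measurable_analyticSigma {Y : Type*} [MeasurableSpace Y]
    [MeasurableSpace.CountablyGenerated Y] {f : X → Y} (hf : Measurable[analyticSigma X] f)
    (μ : Measure X) [IsFiniteMeasure μ] : AEMeasurable f μ := by
  have hle : analyticSigma X ≤ (inferInstance : MeasurableSpace (NullMeasurableSpace X μ)) :=
    MeasurableSpace.generateFrom_le fun s hs ↦ AnalyticSet.nullMeasurableSet hs μ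
  exact NullMeasurable.aemeasurable fun s hs ↦ hle _ (hf hs)

end Selection

/-! ### Upper semianalytic functions and their integrals. -/

section Semianalytic

theorem upperSemianalytic_iff {X : Type*} [TopologicalSpace X] (hX : AnalyticSet (univ : Set X))
    {Φ : X → ℝ≥0∞} :
    UpperSemianalytic (fun x ↦ (Φ x : EReal)) ↔ ∀ c : ℝ≥0∞, AnalyticSet {x | c < Φ x} := by
  constructor
  · intro h c
    induction c with
    | top => simpa using analyticSet_empty
    | coe c =>
      convert h c using 3 with x
      rw [← EReal.coe_ennreal_lt_coe_ennreal_iff]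
      rfl
  · intro h r
    rcases le_or_gt 0 r with hr | hr
    · convert h (ENNReal.ofReal r) using 3 with x
      rw [← EReal.coe_ennreal_lt_coe_ennreal_iff, EReal.coe_ennreal_ofReal, max_eq_left hr]
    · convert hX
      ext x
      simpa using (EReal.coe_lt_coe_iff.2 hr).trans_le (EReal.coe_ennreal_nonneg (Φ x))

theorem measurable_analyticSigma_of_analyticSet_lt {X : Type*} [TopologicalSpace X] {Φ : X → ℝ≥0∞}
    (hΦ : ∀ c : ℝ≥0∞, AnalyticSet {x | c < Φ x}) : Measurable[analyticSigma X] Φ := by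
  let := analyticSigma X
  exact measurable_of_Ioi fun c ↦ measurableSet_analyticSigma (hΦ c)

variable {X : Type*} [MeasurableSpace X]

theorem volume_setOf_ofReal_lt (a : ℝ≥0∞) :
    volume {t : ℝ | 0 < t ∧ ENNReal.ofReal t < a} = a := by
  induction a with
  | top =>
    have : {t : ℝ | 0 < t ∧ ENNReal.ofReal t < ⊤} = Ioi 0 := by ext; simp
    rw [this, Real.volume_Ioi]
  | coe a =>
    have : {t : ℝ | 0 < t ∧ ENNReal.ofReal t < a} = Ioo 0 (a : ℝ) := by
      ext t
      simp only [mem_ofPred_eq, mem_Ioo, and_congr_right_iff]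
      intro ht
      rw [← ENNReal.ofReal_coe_nnreal, ENNReal.ofReal_lt_ofReal_iff_of_nonneg ht.le]
    rw [this, Real.volume_Ioo, sub_zero, ENNReal.ofReal_coe_nnreal]

theorem measure_prod_hypograph (μ : Measure X) [SFinite μ] {Φ : X → ℝ≥0∞} (hΦ : AEMeasurable Φ μ) :
    (μ.prod (volume : Measure ℝ)) {p | 0 < p.2 ∧ ENNReal.ofReal p.2 < Φ p.1} = ∫⁻ x, Φ x ∂μ := by
  obtain ⟨Ψ, hΨ, hae⟩ := hΦ
  have hm : MeasurableSet {p : X × ℝ | 0 < p.2 ∧ ENNReal.ofReal p.2 < Ψ p.1} :=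
    (measurableSet_lt measurable_const measurable_snd).inter
      (measurableSet_lt measurable_snd.ennreal_ofReal (hΨ.comp measurable_fst))
  have h := Measure.quasiMeasurePreserving_fst (ν := (volume : Measure ℝ)) |>.ae_eq_comp hae
  rw [lintegral_congr_ae hae, measure_congr (t := {p | 0 < p.2 ∧ ENNReal.ofReal p.2 < Ψ p.1}),
    Measure.prod_apply hm]
  · exact lintegral_congr fun x ↦ volume_setOf_ofReal_lt (Ψ x)
  · filter_upwards [h] with p hp
    simp only [Function.comp_apply] at hp
    refine propext ?_
    change (0 < p.2 ∧ ENNReal.ofReal p.2 < Φ p.1) ↔ (0 < p.2 ∧ ENNReal.ofReal p.2 < Ψ p.1)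
    rw [hp]

variable [TopologicalSpace X] [SecondCountableTopology X] [T2Space X] [OpensMeasurableSpace X]
  [StandardBorelSpace X]

/-- The integral is the mass of the hypograph, an analytic set, under the product with Lebesgue
measure. Restricting the latter to `Ioc 0 n` makes the kernel finite, as `setOf_lt_kernel` requires.
-/
theorem analyticSet_lt_lintegral_kernel [BorelSpace X] {T : Type*} [MeasurableSpace T]
    [StandardBorelSpace T] [TopologicalSpace T] [SecondCountableTopology T]
    [OpensMeasurableSpace T] {Φ : X → ℝ≥0∞} (hΦ : ∀ c : ℝ≥0∞, AnalyticSet {x | c < Φ x})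
    (κ : Kernel T X) [IsFiniteKernel κ] (c : ℝ≥0∞) :
    AnalyticSet {t | c < ∫⁻ x, Φ x ∂κ t} := by
  let H : Set (X × ℝ) := {p | 0 < p.2 ∧ ENNReal.ofReal p.2 < Φ p.1}
  have hH : AnalyticSet H := by
    have : H = ⋃ q : ℚ, Prod.fst ⁻¹' {x | ENNReal.ofReal q < Φ x} ∩ Prod.snd ⁻¹' Ioc 0 (q : ℝ) := by
      ext ⟨x, t⟩
      simp only [H, mem_ofPred_eq, mem_iUnion, mem_inter_iff, mem_preimage, mem_Ioc]
      constructor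
      · rintro ⟨h0, h⟩
        obtain ⟨q, hq0, hq1, hq2⟩ := ENNReal.lt_iff_exists_rat_btwn.1 h
        exact ⟨q, hq2, h0, ((ENNReal.ofReal_lt_ofReal_iff_of_nonneg h0.le).1 hq1).le⟩
      · rintro ⟨q, hq, h0, htq⟩
        exact ⟨h0, (ENNReal.ofReal_le_ofReal htq).trans_lt hq⟩
    rw [this]
    exact AnalyticSet.iUnion fun q ↦ ((hΦ _).preimage_of_measurable measurable_fst).inter
      (analyticSet_of_measurableSet (measurable_snd measurableSet_Ioc))
  have hU : {t | c < ∫⁻ x, Φ x ∂κ t} = ⋃ n : ℕ,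
      {t | c < (κ ×ₖ Kernel.const T ((volume : Measure ℝ).restrict (Ioc 0 (n : ℝ)))) t H} := by
    ext t
    have hΦm : AEMeasurable Φ (κ t) :=
      aemeasurable_of_measurable_analyticSigma (measurable_analyticSigma_of_analyticSet_lt hΦ) _
    have hHU : H = ⋃ n : ℕ, H ∩ univ ×ˢ Ioc 0 (n : ℝ) := by
      rw [← inter_iUnion, eq_comm, inter_eq_left]
      rintro ⟨x, t⟩ ⟨h0, -⟩
      obtain ⟨n, hn⟩ := exists_nat_ge t
      exact mem_iUnion.2 ⟨n, mem_univ _, h0, hn⟩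
    have hd : Directed (· ⊆ ·) fun n : ℕ ↦ H ∩ univ ×ˢ Ioc 0 (n : ℝ) :=
      Monotone.directed_le fun n m hnm ↦ inter_subset_inter_right _
        (prod_mono_right (Ioc_subset_Ioc_right (by exact_mod_cast hnm)))
    rw [mem_ofPred_eq, ← measure_prod_hypograph _ hΦm]
    change c < ((κ t).prod volume) H ↔ _
    rw [hHU, hd.measure_iUnion, lt_iSup_iff, mem_iUnion, ← hHU]
    refine exists_congr fun n ↦ ?_
    rw [mem_ofPred_eq, Kernel.prod_apply, Kernel.const_apply,
      ← Measure.restrict_univ (μ := κ t), Measure.prod_restrict, Measure.restrict_univ,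
      Measure.restrict_apply' (MeasurableSet.univ.prod measurableSet_Ioc)]
  rw [hU]
  exact AnalyticSet.iUnion fun n ↦ hH.setOf_lt_kernel _ c

end Semianalytic

/-! ### The gain operator and the integral formula of (i). -/

section Gain

theorem setOf_lt_gain {E : Type*} [MeasurableSpace E] (J : Set (E × ProbabilityMeasure E))
    (Φ : E → ℝ≥0∞) (c : ℝ≥0∞) :
    {x | c < gain J Φ x} = Prod.fst '' (J ∩ {p | c < pairing p.2 Φ}) := by
  ext x
  simp [gain, supPairing, lt_iSup_iff]

theorem isAdmissible_iff {E : Type*} [TopologicalSpace E] [MeasurableSpace E]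
    {J : Set (E × ProbabilityMeasure E)}
    {κ : E → ProbabilityMeasure E} :
    IsAdmissible J κ ↔ Measurable[analyticSigma E] κ ∧ ∀ x, (x, κ x) ∈ J := by
  refine ⟨fun h ↦ ⟨?_, h.mem⟩, fun h ↦ ⟨fun B hB ↦ ?_, h.2⟩⟩
  · exact @Measurable.subtype_mk _ _ (analyticSigma E) _ _ _
      (@Measure.measurable_of_measurable_coe _ _ _ (analyticSigma E) _ h.measurable) fun x ↦ (κ x).2
  · exact (Measure.measurable_coe hB).comp (measurable_subtype_coe.comp h.1)

variable {E : Type*} [TopologicalSpace E] [MeasurableSpace E] [BorelSpace E]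

theorem borel_le_analyticSigma [SecondCountableTopology E] [StandardBorelSpace E] :
    (inferInstance : MeasurableSpace E) ≤ analyticSigma E :=
  fun _ hs ↦ measurableSet_analyticSigma (analyticSet_of_measurableSet hs)

section AdmissibleComposition

variable [T2Space E] [StandardBorelSpace E]

theorem IsAdmissible.aemeasurable {J : Set (E × ProbabilityMeasure E)}
    {κ : E → ProbabilityMeasure E} (h : IsAdmissible J κ) (μ : Measure E) [IsFiniteMeasure μ] :
    AEMeasurable (fun x ↦ (κ x : Measure E)) μ :=
  measurable_subtype_coe.comp_aemeasurable
    (aemeasurable_of_measurable_analyticSigma (isAdmissible_iff.1 h).1 μ)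

theorem IsAdmissible.isComposition_iff {J : Set (E × ProbabilityMeasure E)}
    {κ : E → ProbabilityMeasure E} (h : IsAdmissible J κ) {m ν : ProbabilityMeasure E} :
    IsComposition m κ ν ↔ (ν : Measure E) = (m : Measure E).bind fun x ↦ (κ x : Measure E) := by
  refine ⟨fun hν ↦ Measure.ext fun B hB ↦ ?_, fun hν B hB ↦ ?_⟩
  · rw [hν B hB, Measure.bind_apply hB (h.aemeasurable _)]
    rfl
  · rw [hν, Measure.bind_apply hB (h.aemeasurable _)]
    rfl

theorem IsAdmissible.exists_isComposition {J : Set (E × ProbabilityMeasure E)}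
    {κ : E → ProbabilityMeasure E} (h : IsAdmissible J κ) (m : ProbabilityMeasure E) :
    ∃ ν, IsComposition m κ ν :=
  ⟨⟨_, isProbabilityMeasure_bind (h.aemeasurable m) (ae_of_all _ fun _ ↦ inferInstance)⟩,
    h.isComposition_iff.2 rfl⟩

theorem pairing_of_isComposition {J : Set (E × ProbabilityMeasure E)}
    {κ : E → ProbabilityMeasure E} (h : IsAdmissible J κ) {m ν : ProbabilityMeasure E}
    (hν : IsComposition m κ ν) {Φ : E → ℝ≥0∞} (hΦ : ∀ c : ℝ≥0∞, AnalyticSet {x | c < Φ x}) :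
    pairing ν Φ = ∫⁻ x, pairing (κ x) Φ ∂(m : Measure E) := by
  have hν' := h.isComposition_iff.1 hν
  have hm : AEMeasurable Φ (ν : Measure E) :=
    aemeasurable_of_measurable_analyticSigma (measurable_analyticSigma_of_analyticSet_lt hΦ) _
  rw [hν'] at hm
  rw [pairing, hν', Measure.lintegral_bind (h.aemeasurable _) hm]
  rfl

end AdmissibleComposition

variable [SecondCountableTopology E] [MetrizableSpace E]

theorem IsHouse.exists_isAdmissible {J : Set (E × ProbabilityMeasure E)} (hJ : IsHouse J) :
    ∃ κ, IsAdmissible J κ := by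
  rcases J.eq_empty_or_nonempty with rfl | hne
  · have : IsEmpty E := ⟨fun x ↦ (hJ.nonempty_section x).elim fun _ h ↦ h⟩
    exact ⟨isEmptyElim, isAdmissible_iff.2
      ⟨@measurable_of_empty _ _ (analyticSigma E) _ _ _, isEmptyElim⟩⟩
  · obtain ⟨s, hs, h⟩ := hJ.analytic.exists_measurable_selection hne
    refine ⟨s, isAdmissible_iff.2 ⟨hs, fun x ↦ h x ?_⟩⟩
    obtain ⟨μ, hμ⟩ := hJ.nonempty_section x
    exact ⟨_, hμ, rfl⟩

variable [StandardBorelSpace E]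

theorem analyticSet_lt_pairing {Φ : E → ℝ≥0∞} (hΦ : ∀ c : ℝ≥0∞, AnalyticSet {x | c < Φ x})
    (c : ℝ≥0∞) : AnalyticSet {μ : ProbabilityMeasure E | c < pairing μ Φ} := by
  let κ : Kernel (ProbabilityMeasure E) E := ⟨fun μ ↦ μ, measurable_subtype_coe⟩
  have : IsMarkovKernel κ := ⟨fun μ ↦ μ.2⟩
  exact analyticSet_lt_lintegral_kernel hΦ κ c

theorem analyticSet_inter_lt_pairing {J : Set (E × ProbabilityMeasure E)} (hJ : AnalyticSet J)
    {Φ : E → ℝ≥0∞} (hΦ : ∀ c : ℝ≥0∞, AnalyticSet {x | c < Φ x}) (c : ℝ≥0∞) :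
    AnalyticSet (J ∩ {p | c < pairing p.2 Φ}) :=
  hJ.inter ((analyticSet_lt_pairing hΦ c).preimage_of_measurable measurable_snd)

theorem analyticSet_lt_gain {J : Set (E × ProbabilityMeasure E)} (hJ : AnalyticSet J)
    {Φ : E → ℝ≥0∞} (hΦ : ∀ c : ℝ≥0∞, AnalyticSet {x | c < Φ x}) (c : ℝ≥0∞) :
    AnalyticSet {x | c < gain J Φ x} := by
  rw [setOf_lt_gain]
  exact (analyticSet_inter_lt_pairing hJ hΦ c).image_of_continuous continuous_fst

theorem IsHouse.exists_isAdmissible_le_pairing {J : Set (E × ProbabilityMeasure E)}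
    (hJ : IsHouse J) {Φ : E → ℝ≥0∞} (hΦ : ∀ c : ℝ≥0∞, AnalyticSet {x | c < Φ x}) (c : ℝ≥0∞) :
    ∃ κ, IsAdmissible J κ ∧ ∀ x, c < gain J Φ x → c ≤ pairing (κ x) Φ := by
  obtain ⟨κ₀, hκ₀⟩ := hJ.exists_isAdmissible
  have hG := measurableSet_analyticSigma (analyticSet_lt_gain hJ.analytic hΦ c)
  rcases (J ∩ {p | c < pairing p.2 Φ}).eq_empty_or_nonempty with he | hne
  · refine ⟨κ₀, hκ₀, fun x hx ↦ ?_⟩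
    have : x ∈ {x | c < gain J Φ x} := hx
    rw [setOf_lt_gain, he, image_empty] at this
    exact this.elim
  obtain ⟨s, hs, h⟩ :=
    (analyticSet_inter_lt_pairing hJ.analytic hΦ c).exists_measurable_selection hne
  rw [← setOf_lt_gain] at h
  classical
  refine ⟨fun x ↦ if c < gain J Φ x then s x else κ₀ x, isAdmissible_iff.2 ⟨?_, fun x ↦ ?_⟩,
    fun x hx ↦ ?_⟩
  · exact measurable_analyticSigma_ite hG hs (isAdmissible_iff.1 hκ₀).1
  · by_cases hx : c < gain J Φ x
    · simpa [hx] using (h x hx).1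
    · simpa [hx] using hκ₀.mem x
  · simpa [hx] using (h x hx).2.le

/-- Finitely many selections are patched so that each point uses one suited to the highest level
below its gain. Working with levels avoids a separate treatment of infinite gain. -/
theorem IsHouse.exists_isAdmissible_forall_le_pairing {J : Set (E × ProbabilityMeasure E)}
    (hJ : IsHouse J) {Φ : E → ℝ≥0∞} (hΦ : ∀ c : ℝ≥0∞, AnalyticSet {x | c < Φ x})
    (r : ℕ → ℝ≥0∞) (n : ℕ) :
    ∃ κ, IsAdmissible J κ ∧ ∀ i < n, ∀ x, r i < gain J Φ x → r i ≤ pairing (κ x) Φ := by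
  induction n with
  | zero => simpa using hJ.exists_isAdmissible
  | succ n ih =>
    obtain ⟨κ, hκ, h⟩ := ih
    obtain ⟨s, hs, h'⟩ := hJ.exists_isAdmissible_le_pairing hΦ (r n)
    have hG : ∀ c, MeasurableSet[analyticSigma E] {x | c < gain J Φ x} :=
      fun c ↦ measurableSet_analyticSigma (analyticSet_lt_gain hJ.analytic hΦ c)
    -- On `S` the new level dominates every earlier level below the gain; off `S` the old kernel
    -- already suffices.
    let S : Set E := {x | r n < gain J Φ x ∧ ∀ i < n, r i < gain J Φ x → r i ≤ r n}
    have hS : MeasurableSet[analyticSigma E] S := by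
      have : S = {x | r n < gain J Φ x} ∩
          ⋂ i, ⋂ (_ : i < n), {x | r i < gain J Φ x}ᶜ ∪ {_x | r i ≤ r n} := by
        ext x
        simp only [S, mem_ofPred_eq, mem_inter_iff, mem_iInter, mem_union, mem_compl_iff,
          imp_iff_not_or]
      rw [this]
      exact (hG _).inter (MeasurableSet.iInter fun i ↦ MeasurableSet.iInter fun _ ↦
        (hG _).compl.union (MeasurableSet.const _))
    classical
    refine ⟨fun x ↦ if x ∈ S then s x else κ x, isAdmissible_iff.2 ⟨?_, fun x ↦ ?_⟩,
      fun i hi x hx ↦ ?_⟩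
    · exact measurable_analyticSigma_ite hS (isAdmissible_iff.1 hs).1
        (isAdmissible_iff.1 hκ).1
    · by_cases hx : x ∈ S
      · simpa [hx] using hs.mem x
      · simpa [hx] using hκ.mem x
    · by_cases hxS : x ∈ S
      · simp only [hxS, if_true]
        rcases Nat.lt_succ_iff_lt_or_eq.1 hi with hi | rfl
        · exact (hxS.2 i hi hx).trans (h' x hxS.1)
        · exact h' x hx
      · simp only [hxS, if_false]
        rcases Nat.lt_succ_iff_lt_or_eq.1 hi with hi | rfl
        · exact h i hi x hx
        · have : ∃ j < i, r j < gain J Φ x ∧ r i < r j := by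
            by_contra! hcon
            exact hxS ⟨hx, hcon⟩
          obtain ⟨j, hj, hjx, hij⟩ := this
          exact hij.le.trans (h j hj x hjx)

theorem IsHouse.supPairing_measureComp {J : Set (E × ProbabilityMeasure E)} (hJ : IsHouse J)
    {Φ : E → ℝ≥0∞} (hΦ : ∀ c : ℝ≥0∞, AnalyticSet {x | c < Φ x}) (m : ProbabilityMeasure E) :
    supPairing (measureComp m J) Φ = pairing m (gain J Φ) := by
  apply le_antisymm
  · refine iSup₂_le fun ν ⟨κ, hκ, hν⟩ ↦ ?_
    rw [pairing_of_isComposition hκ hν hΦ]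
    exact lintegral_mono fun x ↦ le_iSup₂_of_le (κ x) (hκ.mem x) le_rfl
  obtain ⟨q, hq⟩ := exists_surjective_nat ℚ
  let r : ℕ → ℝ≥0∞ := fun n ↦ ENNReal.ofReal (q n)
  let t : ℕ → E → ℝ≥0∞ := fun i ↦ {x | r i < gain J Φ x}.indicator fun _ ↦ r i
  -- `s n x` is the largest of the first `n` levels strictly below the gain at `x`, or `0`; it
  -- increases to the gain.
  let s : ℕ → E → ℝ≥0∞ := fun n x ↦ ⨆ i, ⨆ (_ : i < n), t i x
  have hs : ∀ n, AEMeasurable (s n) (m : Measure E) := fun n ↦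
    .iSup fun i ↦ .iSup fun _ ↦ aemeasurable_const.indicator₀
      ((analyticSet_lt_gain hJ.analytic hΦ (r i)).nullMeasurableSet _)
  have hmono : Monotone s := fun n k hnk x ↦
    iSup_mono fun i ↦ iSup_const_mono fun hi ↦ hi.trans_le hnk
  have hgain : ∀ x, gain J Φ x ≤ ⨆ n, s n x := by
    refine fun x ↦ le_of_forall_lt fun c hc ↦ ?_
    obtain ⟨p, -, hcp, hp⟩ := ENNReal.lt_iff_exists_rat_btwn.1 hc
    obtain ⟨i, rfl⟩ := hq p
    refine hcp.trans_le (le_iSup_of_le (i + 1) (le_iSup₂_of_le i i.lt_succ_self ?_))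
    exact (indicator_of_mem (s := {x | r i < gain J Φ x}) hp fun _ ↦ r i).ge
  calc pairing m (gain J Φ) ≤ ∫⁻ x, ⨆ n, s n x ∂(m : Measure E) := lintegral_mono hgain
    _ = ⨆ n, ∫⁻ x, s n x ∂(m : Measure E) :=
      lintegral_iSup' hs (ae_of_all _ fun x ↦ fun n k hnk ↦ hmono hnk x)
    _ ≤ supPairing (measureComp m J) Φ := iSup_le fun n ↦ ?_
  obtain ⟨κ, hκ, h⟩ := hJ.exists_isAdmissible_forall_le_pairing hΦ r n
  obtain ⟨ν, hν⟩ := hκ.exists_isComposition m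
  refine le_iSup₂_of_le ν ⟨κ, hκ, hν⟩ ?_
  rw [pairing_of_isComposition hκ hν hΦ]
  refine lintegral_mono fun x ↦ iSup₂_le fun i hi ↦ ?_
  by_cases hx : r i < gain J Φ x
  · simpa [t, hx] using h i hi x hx
  · simp [t, hx]

theorem IsHouse.gain_houseComp {J K : Set (E × ProbabilityMeasure E)} (hK : IsHouse K)
    {Φ : E → ℝ≥0∞} (hΦ : ∀ c : ℝ≥0∞, AnalyticSet {x | c < Φ x}) :
    gain (houseComp J K) Φ = gain J (gain K Φ) := by
  ext x
  have h : gain (houseComp J K) Φ x = ⨆ μ ∈ {μ | (x, μ) ∈ J}, supPairing (measureComp μ K) Φ := by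
    simp only [gain, supPairing, houseComp, mem_ofPred_eq, iSup_exists, iSup_and]
    rw [iSup_comm]
    refine iSup_congr fun μ ↦ ?_
    rw [iSup_comm]
  rw [h]
  exact iSup_congr fun μ ↦ iSup_congr fun _ ↦ hK.supPairing_measureComp hΦ μ

end Gain

/-! ### Composition of houses through joint laws, and statement (ii). -/

section AdmissibleComposition

/-- The identity kernel on probability measures. -/
noncomputable def evalKernel (X : Type*) [MeasurableSpace X] : Kernel (ProbabilityMeasure X) X :=
  ⟨fun μ ↦ μ, measurable_subtype_coe⟩

instance (X : Type*) [MeasurableSpace X] : IsMarkovKernel (evalKernel X) := ⟨fun μ ↦ μ.2⟩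

theorem exists_measurable_map {X Y : Type*} [MeasurableSpace X] [MeasurableSpace Y] {f : X → Y}
    (hf : Measurable f) : ∃ F : ProbabilityMeasure X → ProbabilityMeasure Y,
      Measurable F ∧ ∀ μ, (F μ : Measure Y) = (μ : Measure X).map f :=
  ⟨fun μ ↦ ⟨(μ : Measure X).map f, Measure.isProbabilityMeasure_map hf.aemeasurable⟩,
    ((Measure.measurable_map f hf).comp measurable_subtype_coe).subtype_mk, fun _ ↦ rfl⟩

/-- A jointly measurable version of the disintegration of a law on `E × E`. -/
theorem exists_measurable_disintegration {E : Type*} [MeasurableSpace E]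
    [StandardBorelSpace E] [Nonempty E] :
    ∃ k : ProbabilityMeasure (E × E) × E → ProbabilityMeasure E, Measurable k ∧
      ∀ γ : ProbabilityMeasure (E × E), (fun y ↦ (k (γ, y) : Measure E))
        =ᵐ[(γ : Measure (E × E)).fst] (γ : Measure (E × E)).condKernel := by
  let ρ := evalKernel (E × E)
  refine ⟨fun p ↦ ⟨ρ.condKernel p, inferInstance⟩, ρ.condKernel.measurable.subtype_mk, fun γ ↦ ?_⟩
  have h := Kernel.condKernel_apply_eq_condKernel ρ γ
  rwa [Kernel.fst_apply] at h

theorem IsBorelSubsetOfPolish.standard {E : Type*} [TopologicalSpace E]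
    [MeasurableSpace E] [BorelSpace E] (hE : IsBorelSubsetOfPolish E) :
    SecondCountableTopology E ∧ MetrizableSpace E ∧ StandardBorelSpace E := by
  obtain ⟨X, _, _, e, he, hr⟩ := hE
  borelize X
  have hs : StandardBorelSpace (range e) := hr.standardBorel
  exact ⟨he.secondCountableTopology, he.metrizableSpace,
    standardBorelSpace_of_measurableEquiv (he.measurableEmbedding hr).equivRange⟩

variable {E : Type*} [TopologicalSpace E] [MeasurableSpace E] [BorelSpace E]
  [SecondCountableTopology E] [MetrizableSpace E] [StandardBorelSpace E]

/-- The section of `N` at `t` has the mass of `N` itself under `δ_t × κ t`, so full measure is a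
countable intersection of conditions covered by `setOf_lt_kernel`. -/
theorem analyticSet_ae_mem {T : Type*} [MeasurableSpace T] [StandardBorelSpace T]
    [TopologicalSpace T] [SecondCountableTopology T] [BorelSpace T] [T2Space T]
    {N : Set (T × E)} (hN : AnalyticSet N) (κ : Kernel T E) [IsMarkovKernel κ] :
    AnalyticSet {t | ∀ᵐ y ∂κ t, (t, y) ∈ N} := by
  have h : {t | ∀ᵐ y ∂κ t, (t, y) ∈ N} =
      ⋂ q : {q : ℚ // ENNReal.ofReal q < 1}, {t | ENNReal.ofReal q < (Kernel.id ×ₖ κ) t N} := by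
    ext t
    have hNt : NullMeasurableSet (Prod.mk t ⁻¹' N) (κ t) :=
      (hN.preimage_of_measurable measurable_prodMk_left).nullMeasurableSet _
    have heq : (Kernel.id ×ₖ κ) t N = κ t (Prod.mk t ⁻¹' N) := by
      have h0 := hN.nullMeasurableSet ((Kernel.id ×ₖ κ) t)
      rw [Kernel.prod_apply, Kernel.id_apply, Measure.dirac_prod] at h0 ⊢
      exact Measure.map_apply₀ measurable_prodMk_left.aemeasurable h0
    simp only [mem_iInter, mem_ofPred_eq, heq]
    have hae : (∀ᵐ y ∂κ t, (t, y) ∈ N) ↔ κ t (Prod.mk t ⁻¹' N) = 1 :=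
      prob_compl_eq_zero_iff₀ hNt
    rw [hae]
    refine ⟨fun h q ↦ q.2.trans_eq h.symm, fun h ↦ le_antisymm prob_le_one (le_of_forall_lt fun c hc ↦ ?_)⟩
    obtain ⟨q, -, hcq, hq⟩ := ENNReal.lt_iff_exists_rat_btwn.1 hc
    exact hcq.trans (h ⟨q, hq⟩)
  rw [h]
  have : Nonempty {q : ℚ // ENNReal.ofReal q < 1} := ⟨0, by simp⟩
  exact AnalyticSet.iInter fun q ↦ hN.setOf_lt_kernel _ _

/-- Disintegrating the joint law of `μ` and a kernel recovers that kernel almost everywhere.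
Conversely, the disintegration of `γ` becomes admissible once redefined, on a null set, by any
admissible kernel. -/
theorem mem_measureComp_iff [Nonempty E] {K : Set (E × ProbabilityMeasure E)} (hK : IsHouse K)
    {k : ProbabilityMeasure (E × E) × E → ProbabilityMeasure E} (hkm : Measurable k)
    (hk : ∀ γ : ProbabilityMeasure (E × E), (fun y ↦ (k (γ, y) : Measure E))
        =ᵐ[(γ : Measure (E × E)).fst] (γ : Measure (E × E)).condKernel)
    {μ ν : ProbabilityMeasure E} :
    ν ∈ measureComp μ K ↔ ∃ γ : ProbabilityMeasure (E × E), (γ : Measure (E × E)).fst = μ ∧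
      (γ : Measure (E × E)).snd = ν ∧ ∀ᵐ y ∂(μ : Measure E), (y, k (γ, y)) ∈ K := by
  constructor
  · rintro ⟨κ, hκ, hν⟩
    rw [hκ.isComposition_iff] at hν
    -- `κ` is only `analyticSigma E`-measurable; a Borel version is needed to form the joint law.
    obtain ⟨κ', hκ', hae⟩ := aemeasurable_of_measurable_analyticSigma
      (isAdmissible_iff.1 hκ).1 (μ : Measure E)
    let η : Kernel E E := ⟨fun x ↦ κ' x, measurable_subtype_coe.comp hκ'⟩
    have : IsMarkovKernel η := ⟨fun x ↦ (κ' x).2⟩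
    refine ⟨⟨(μ : Measure E) ⊗ₘ η, inferInstance⟩, ?_, ?_, ?_⟩
    · exact Measure.fst_compProd _ _
    · rw [hν]
      refine (Measure.snd_compProd _ _).trans (Measure.bind_congr_right ?_)
      filter_upwards [hae] with x hx
      rw [hx]
      rfl
    · have h1 := hk ⟨(μ : Measure E) ⊗ₘ η, inferInstance⟩
      simp only [ProbabilityMeasure.coe_mk, Measure.fst_compProd] at h1
      filter_upwards [hae, h1, condKernel_compProd (μ : Measure E) η] with x hx h1 h2
      have : k (⟨(μ : Measure E) ⊗ₘ η, inferInstance⟩, x) = κ x :=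
        Subtype.ext ((h1.trans h2).trans (congrArg Subtype.val hx.symm))
      rw [this]
      exact hκ.mem x
  · rintro ⟨γ, hfst, hsnd, hae⟩
    obtain ⟨κ₀, hκ₀⟩ := hK.exists_isAdmissible
    have hN : AnalyticSet {y | (y, k (γ, y)) ∈ K} :=
      hK.analytic.preimage_of_measurable
        (measurable_id.prodMk (hkm.comp measurable_prodMk_left))
    classical
    have hκ : IsAdmissible K fun y ↦ if (y, k (γ, y)) ∈ K then k (γ, y) else κ₀ y := by
      refine isAdmissible_iff.2 ⟨?_, fun y ↦ ?_⟩
      · exact measurable_analyticSigma_ite (measurableSet_analyticSigma hN)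
          ((hkm.comp measurable_prodMk_left).mono borel_le_analyticSigma le_rfl)
          (isAdmissible_iff.1 hκ₀).1
      · by_cases hy : (y, k (γ, y)) ∈ K
        · simp [hy]
        · simpa [hy] using hκ₀.mem y
    refine ⟨_, hκ, hκ.isComposition_iff.2 ?_⟩
    rw [← hsnd, ← Measure.disintegrate (γ : Measure (E × E)) (γ : Measure (E × E)).condKernel,
      Measure.snd_compProd, hfst]
    refine Measure.bind_congr_right ?_
    have h1 := hk γ
    rw [hfst] at h1
    filter_upwards [h1, hae] with y h1 h2
    rw [← h1, if_pos h2]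

/-- The composition is the image, under `(x, γ) ↦ (x, second marginal of γ)`, of the pairs for which
the first marginal lies in `J_x` and the disintegration of `γ` lies almost surely in `K`. -/
theorem analyticSet_houseComp {J K : Set (E × ProbabilityMeasure E)} (hJ : AnalyticSet J)
    (hK : IsHouse K) : AnalyticSet (houseComp J K) := by
  cases isEmpty_or_nonempty E
  · rw [eq_empty_of_isEmpty (houseComp J K)]
    exact analyticSet_empty
  obtain ⟨k, hkm, hk⟩ := exists_measurable_disintegration (E := E)
  obtain ⟨F, hFm, hF⟩ := exists_measurable_map (X := E × E) (Y := E) measurable_fst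
  obtain ⟨G, hGm, hG⟩ := exists_measurable_map (X := E × E) (Y := E) measurable_snd
  have hN : AnalyticSet {p : ProbabilityMeasure (E × E) × E | (p.2, k p) ∈ K} :=
    hK.analytic.preimage_of_measurable (measurable_snd.prodMk hkm)
  have hB := analyticSet_ae_mem hN (Kernel.fst (evalKernel (E × E)))
  have hJ' : AnalyticSet {p : E × ProbabilityMeasure (E × E) | (p.1, F p.2) ∈ J} :=
    hJ.preimage_of_measurable (measurable_fst.prodMk (hFm.comp measurable_snd))
  have hGm' : Measurable fun p : E × ProbabilityMeasure (E × E) ↦ (p.1, G p.2) :=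
    measurable_fst.prodMk (hGm.comp measurable_snd)
  convert (hJ'.inter (hB.preimage_of_measurable measurable_snd)).image_of_measurable hGm'
  ext ⟨x, ν⟩
  simp only [houseComp, mem_ofPred_eq, mem_measureComp_iff hK hkm hk, mem_image, mem_inter_iff,
    mem_preimage, Prod.exists, Prod.mk.injEq, Kernel.fst_apply]
  constructor
  · rintro ⟨μ, hμ, γ, hfst, hsnd, hae⟩
    have hFγ : F γ = μ := Subtype.ext ((hF γ).trans hfst)
    refine ⟨x, γ, ⟨by rwa [hFγ], ?_⟩, rfl, Subtype.ext ((hG γ).trans hsnd)⟩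
    rw [← hfst] at hae
    exact hae
  · rintro ⟨x, γ, ⟨hx, hae⟩, rfl, rfl⟩
    refine ⟨F γ, hx, γ, (hF γ).symm, (hG γ).symm, ?_⟩
    rw [hF γ]
    exact hae

theorem IsHouse.houseComp {J K : Set (E × ProbabilityMeasure E)} (hJ : IsHouse J)
    (hK : IsHouse K) : IsHouse (houseComp J K) := by
  refine ⟨analyticSet_houseComp hJ.analytic hK, fun x ↦ ?_⟩
  obtain ⟨μ, hμ⟩ := hJ.nonempty_section x
  obtain ⟨κ, hκ⟩ := hK.exists_isAdmissible
  obtain ⟨ν, hν⟩ := hκ.exists_isComposition μ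
  exact ⟨ν, μ, hμ, κ, hκ, hν⟩

theorem isHouse_houseCompSeq (n : ℕ) (J : Fin (n + 1) → Set (E × ProbabilityMeasure E))
    (hJ : ∀ i, IsHouse (J i)) : IsHouse (houseCompSeq n J) := by
  induction n with
  | zero => exact hJ 0
  | succ n ih => exact (hJ 0).houseComp (ih _ fun i ↦ hJ i.succ)

theorem gain_houseCompSeq (n : ℕ) (J : Fin (n + 1) → Set (E × ProbabilityMeasure E))
    (hJ : ∀ i, IsHouse (J i)) {Φ : E → ℝ≥0∞} (hΦ : ∀ c : ℝ≥0∞, AnalyticSet {x | c < Φ x}) :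
    gain (houseCompSeq n J) Φ = gainSeq n J Φ := by
  induction n with
  | zero => rfl
  | succ n ih =>
    rw [houseCompSeq, gainSeq, ← ih _ fun i ↦ hJ i.succ]
    exact (isHouse_houseCompSeq n _ fun i ↦ hJ i.succ).gain_houseComp hΦ

end AdmissibleComposition

end GamblingHouse

theorem mainTheorem6 {E : Type*} [TopologicalSpace E] [MeasurableSpace E] [BorelSpace E]
    (hE : GamblingHouse.IsBorelSubsetOfPolish E)
    (Φ : E → ℝ≥0∞) (hΦ : GamblingHouse.UpperSemianalytic (fun x => (Φ x : EReal))) :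
    (∀ J : Set (E × ProbabilityMeasure E), GamblingHouse.IsHouse J →
      GamblingHouse.UpperSemianalytic (fun x => (GamblingHouse.gain J Φ x : EReal)) ∧
      ∀ m : ProbabilityMeasure E,
        GamblingHouse.supPairing (GamblingHouse.measureComp m J) Φ =
          GamblingHouse.pairing m (GamblingHouse.gain J Φ)) ∧
    (∀ (n : ℕ) (J : Fin (n + 1) → Set (E × ProbabilityMeasure E)),
      (∀ i, GamblingHouse.IsHouse (J i)) →
      GamblingHouse.IsHouse (GamblingHouse.houseCompSeq n J) ∧
      GamblingHouse.gain (GamblingHouse.houseCompSeq n J) Φ = GamblingHouse.gainSeq n J Φ) := by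
  obtain ⟨_, _, _⟩ := hE.standard
  have huniv : AnalyticSet (Set.univ : Set E) :=
    GamblingHouse.analyticSet_of_measurableSet MeasurableSet.univ
  rw [GamblingHouse.upperSemianalytic_iff huniv] at hΦ
  refine ⟨fun J hJ ↦ ⟨?_, hJ.supPairing_measureComp hΦ⟩, fun n J hJ ↦
    ⟨GamblingHouse.isHouse_houseCompSeq n J hJ, GamblingHouse.gain_houseCompSeq n J hJ hΦ⟩⟩
  rw [GamblingHouse.upperSemianalytic_iff huniv]
  exact GamblingHouse.analyticSet_lt_gain hJ.analytic hΦ
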